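/- Let $n\ge 0$ be an integer and let $\alpha,\beta>-1$ be real. Let $P_{n+1}^{(\alpha,\beta)}$ be the Jacobi polynomial of degree $n+1$, $$P_{N}^{(\alpha,\beta)}(x)=\frac1{N!}\sum_{k=0}^{N}\binom Nk\,(N+\alpha+\beta+1)_k\,(\alpha+k+1)_{N-k}\Big(\frac{x-1}{2}\Big)^k ,\qquad (a)_k=a(a+1)\cdots(a+k-1).$$ It has exactly $n+1$ distinct real roots, all in $(-1,1)$. Let $x_0,\dots,x_n$ be these roots in monotonic order, let $$\lambda_j=\frac{1}{\prod_{k\ne j}(x_j-x_k)},\qquad j=0,\dots,n,$$ be their barycentric weights, and let $$w_j=\int_{-1}^{1}(1-t)^\alpha(1+t)^\beta\prod_{k\neq j}\frac{t-x_k}{x_j-x_k}\,dt,\qquad j=0,\dots,n,$$ be the weights of the Gaussian quadrature rule with nodes $x_0,\dots,x_n$ for the weight function $(1-t)^\alpha(1+t)^\beta$ on $(-1,1)$. (a) If the roots are ordered increasingly, $x_0<x_1<\dots<x_n$, then $$\lambda_j=C_n^{(\alpha,\beta)}\,(-1)^j\sqrt{(1-x_j^2)\,w_j},\qquad j=0,\dots,n,$$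 where $$C_n^{(\alpha,\beta)}=\sigma\,\frac{\Gamma(2n+\alpha+\beta+3)}{2^{\,n+1+\frac{\alpha+\beta+1}{2}}}\,\frac{1}{\sqrt{(n+1)!\;\Gamma(n+\alpha+\beta+2)\,\Gamma(n+\alpha+2)\,\Gamma(n+\beta+2)}},$$ with $\sigma=+1$ for even $n$ and $\sigma=-1$ for odd $n$. (b) If the roots are ordered monotonically (increasingly or decreasingly), then the numbers $(-1)^j\sqrt{(1-x_j^2)\,w_j}$, $j=0,\dots,n$, are simplified barycentric weights: there is a constant $c\ne0$, independent of $j$, with $\lambda_j=c\,(-1)^j\sqrt{(1-x_j^2)\,w_j}$ for all $j=0,\dots,n$. -/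

import Mathlib

open Polynomial

noncomputable section

/-- The Jacobi polynomial `P_N^{(α,β)}`, as its finite hypergeometric sum
`(1 / N!) ∑ₖ (N choose k) (N+α+β+1)ₖ (α+k+1)_{N-k} ((X - 1) / 2)^k`,
where `(a)ₖ = a (a+1) ⋯ (a+k-1)` is the rising factorial. -/
def jacobiPoly (N : ℕ) (α β : ℝ) : ℝ[X] :=
  C ((N.factorial : ℝ)⁻¹) *
    ∑ k ∈ Finset.range (N + 1),
      C ((N.choose k : ℝ) * (ascPochhammer ℝ k).eval ((N : ℝ) + α + β + 1) *
          (ascPochhammer ℝ (N - k)).eval (α + (k : ℝ) + 1)) *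
        (C (1 / 2 : ℝ) * (X - 1)) ^ k

/-- `x 0, …, x n` are precisely the real roots of the Jacobi polynomial `P_{n+1}^{(α,β)}`
(without repetition as soon as `x` is strictly monotonic). -/
def EnumeratesJacobiRoots {n : ℕ} (α β : ℝ) (x : Fin (n + 1) → ℝ) : Prop :=
  ∀ t : ℝ, (jacobiPoly (n + 1) α β).IsRoot t ↔ ∃ j, x j = t

/-- The weight `w_j` of the interpolatory quadrature rule with nodes `x 0, …, x n` for the
weight function `(1 - t)^α (1 + t)^β` on `(-1, 1)`: the integral of the `j`-th Lagrange
fundamental polynomial. When the nodes are the roots of `P_{n+1}^{(α,β)}` this rule is the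
Gaussian (Gauss-Jacobi) quadrature rule. -/
def gaussJacobiWeight {n : ℕ} (α β : ℝ) (x : Fin (n + 1) → ℝ) (j : Fin (n + 1)) : ℝ :=
  ∫ t in (-1 : ℝ)..1,
    (1 - t) ^ α * (1 + t) ^ β * (Lagrange.basis Finset.univ x j).eval t

/-- The barycentric weight `λ_j = 1 / ∏_{k ≠ j} (x_j - x_k)`. -/
def baryWeight {n : ℕ} (x : Fin (n + 1) → ℝ) (j : Fin (n + 1)) : ℝ :=
  1 / ∏ k ∈ Finset.univ.erase j, (x j - x k)

/-- `μ` is a system of simplified barycentric weights for the nodes `x`: it arises from the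
barycentric weights by cancelling a nonzero factor common to all of them. -/
def IsSimplifiedBaryWeights {n : ℕ} (x μ : Fin (n + 1) → ℝ) : Prop :=
  ∃ c : ℝ, c ≠ 0 ∧ ∀ j, baryWeight x j = c * μ j

/-- The sign `σ`: `+1` for even `n`, `-1` for odd `n`. -/
def jacobiSign (n : ℕ) : ℝ := if Even n then 1 else -1

/-- The constant `C_n^{(α,β)}` of the full barycentric weights. -/
def jacobiConst (n : ℕ) (α β : ℝ) : ℝ :=
  jacobiSign n *
    (Real.Gamma (2 * (n : ℝ) + α + β + 3) / (2 : ℝ) ^ ((n : ℝ) + 1 + (α + β + 1) / 2)) *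
    (1 / √(((n + 1).factorial : ℝ) * Real.Gamma ((n : ℝ) + α + β + 2) *
      Real.Gamma ((n : ℝ) + α + 2) * Real.Gamma ((n : ℝ) + β + 2)))

end

/-!
Write `P = P_{n+1}^{(α,β)}`, with leading coefficient `k`, and let `J p` be the integral of `p`
against the Jacobi weight `w(t) = (1 - t)^α (1 + t)^β`.

*Orthogonality and norm.* Two facts link the pair `(α, β)` to `(α+1, β+1)`: the derivative of
`P_{N+1}^{(α,β)}` is `(N+α+β+2)/2` times `P_N^{(α+1,β+1)}` (`derivative_jacobiPoly_succ`), and the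
derivative of `(1-t)^(α+1) (1+t)^(β+1) P_N^{(α+1,β+1)}` is `-2(N+1) w P_{N+1}^{(α,β)}`
(`jacobiPoly_rodrigues_step`). Integration by parts then lowers the degree by one, which yields
orthogonality to all polynomials of lower degree (`jacobiInt_jacobiPoly_mul_eq_zero`) and, ending in
a Beta integral, the value of `J (P²)` (`jacobiInt_jacobiPoly_sq`).

*Roots.* If `P = f S` with `f` nonconstant and of one sign on `(-1, 1)`, then `J (P S) = J (f S²)`
is both zero and nonzero. Hence each irreducible factor of `P` has a root in `(-1, 1)`, so it is
linear, and `(X - a)²` never divides `P`.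

*Weights.* Let `a` be a root and `P = (X - a) S`. The polynomial `r = (1 - X²) P' + (n+1) X P` has
degree at most `n + 1`, so `r S` and `r(a) S` differ by `P` times a polynomial of degree at most
`n`, and `J (r S) = r(a) J S = (1 - a²) S(a) J S`. Integration by parts evaluates `J (r S)` as
`(2n+α+β+3) J (P²)` (`gaussJacobi_weight_identity`). Since the quadrature weight at `a` is
`J S / S(a)` and the barycentric weight is `k / S(a)`, the quotient of `λ_j²` by `(1 - x_j²) w_j` is
`k² / ((2n+α+β+3) J (P²))`, independent of `j`, and this is `C_n²` (`jacobiConst_sq_mul`). The sign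
of `λ_j` is the parity of the number of nodes to the right of `x_j`.
-/

/-! ### The moment functional of the Jacobi weight -/

/-- The moment functional `p ↦ ∫_{-1}^{1} (1 - t)^α (1 + t)^β p(t) dt` of the Jacobi weight. -/
noncomputable def jacobiInt (α β : ℝ) (p : ℝ[X]) : ℝ :=
  ∫ t in (-1 : ℝ)..1, (1 - t) ^ α * (1 + t) ^ β * p.eval t

lemma intervalIntegrable_jacobiWeight {α β : ℝ} (hα : -1 < α) (hβ : -1 < β) :
    IntervalIntegrable (fun t : ℝ => (1 - t) ^ α * (1 + t) ^ β) MeasureTheory.volume (-1) 1 := by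
  have hl : IntervalIntegrable (fun t : ℝ => (1 + t) ^ β) MeasureTheory.volume (-1) 0 := by
    have := (intervalIntegral.intervalIntegrable_rpow' (a := 0) (b := 1) hβ).comp_add_left 1
    simpa using this
  have hr : IntervalIntegrable (fun t : ℝ => (1 - t) ^ α) MeasureTheory.volume 0 1 := by
    have := (intervalIntegral.intervalIntegrable_rpow' (a := 1) (b := 0) hα).comp_sub_left 1
    simpa using this
  refine IntervalIntegrable.trans (b := 0) (hl.continuousOn_mul ?_) (hr.mul_continuousOn ?_)
  · refine ContinuousOn.rpow_const (by fun_prop) fun t ht => Or.inl ?_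
    rw [Set.uIcc_of_le (by norm_num)] at ht
    linarith [ht.2]
  · refine ContinuousOn.rpow_const (by fun_prop) fun t ht => Or.inl ?_
    rw [Set.uIcc_of_le (by norm_num)] at ht
    linarith [ht.1]

lemma intervalIntegrable_jacobiWeight_mul {α β : ℝ} (hα : -1 < α) (hβ : -1 < β) (p : ℝ[X]) :
    IntervalIntegrable (fun t : ℝ => (1 - t) ^ α * (1 + t) ^ β * p.eval t)
      MeasureTheory.volume (-1) 1 :=
  (intervalIntegrable_jacobiWeight hα hβ).mul_continuousOn p.continuous.continuousOn

lemma jacobiInt_add {α β : ℝ} (hα : -1 < α) (hβ : -1 < β) (p q : ℝ[X]) :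
    jacobiInt α β (p + q) = jacobiInt α β p + jacobiInt α β q := by
  unfold jacobiInt
  rw [← intervalIntegral.integral_add (intervalIntegrable_jacobiWeight_mul hα hβ p)
    (intervalIntegrable_jacobiWeight_mul hα hβ q)]
  simp only [eval_add, mul_add]

lemma jacobiInt_C_mul (α β c : ℝ) (p : ℝ[X]) :
    jacobiInt α β (C c * p) = c * jacobiInt α β p := by
  unfold jacobiInt
  rw [← intervalIntegral.integral_const_mul]
  congr 1
  ext t
  simp only [eval_mul, eval_C]
  ring

lemma jacobiInt_zero (α β : ℝ) : jacobiInt α β 0 = 0 := by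
  simp [jacobiInt]

lemma jacobiInt_sub {α β : ℝ} (hα : -1 < α) (hβ : -1 < β) (p q : ℝ[X]) :
    jacobiInt α β (p - q) = jacobiInt α β p - jacobiInt α β q := by
  have h : p - q = p + C (-1) * q := by simp [sub_eq_add_neg]
  rw [h, jacobiInt_add hα hβ, jacobiInt_C_mul]
  ring

/-- Integration by parts: `(1 - t)^(α+1) (1 + t)^(β+1) p(t)` vanishes at both end points, and this
is the integral of its derivative. -/
lemma jacobiInt_parts {α β : ℝ} (hα : -1 < α) (hβ : -1 < β) (p : ℝ[X]) :
    jacobiInt α β ((C (β - α) - C (α + β + 2) * X) * p + (1 - X ^ 2) * derivative p) = 0 := by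
  have key := intervalIntegral.integral_eq_sub_of_hasDerivAt_of_le (a := -1) (b := 1)
    (f := fun t : ℝ => (1 - t) ^ (α + 1) * (1 + t) ^ (β + 1) * p.eval t) (by norm_num) ?_ ?_
    (intervalIntegrable_jacobiWeight_mul hα hβ
      ((C (β - α) - C (α + β + 2) * X) * p + (1 - X ^ 2) * derivative p))
  · unfold jacobiInt
    rw [key]
    have h1 : α + 1 ≠ 0 := by linarith
    have h2 : β + 1 ≠ 0 := by linarith
    simp [Real.zero_rpow h1, Real.zero_rpow h2]
  · refine ContinuousOn.mul (ContinuousOn.mul ?_ ?_) p.continuous.continuousOn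
    · exact ContinuousOn.rpow_const (by fun_prop) fun t _ => Or.inr (by linarith)
    · exact ContinuousOn.rpow_const (by fun_prop) fun t _ => Or.inr (by linarith)
  · intro t ht
    have h1 : 0 < 1 - t := by linarith [ht.2]
    have h2 : 0 < 1 + t := by linarith [ht.1]
    have d1 := ((hasDerivAt_id t).const_sub 1).rpow_const (p := α + 1) (Or.inl h1.ne')
    have d2 := ((hasDerivAt_id t).const_add 1).rpow_const (p := β + 1) (Or.inl h2.ne')
    refine ((d1.mul d2).mul (p.hasDerivAt t)).congr_deriv ?_
    simp only [id, add_sub_cancel_right, Real.rpow_add_one h1.ne', Real.rpow_add_one h2.ne',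
      Pi.mul_apply, eval_add, eval_mul, eval_sub, eval_C, eval_X, eval_pow, eval_one]
    ring

/-- Raising both exponents by one multiplies the weight by `1 - t²`. -/
lemma jacobiInt_add_one (α β : ℝ) (p : ℝ[X]) :
    jacobiInt (α + 1) (β + 1) p = jacobiInt α β ((1 - X ^ 2) * p) := by
  unfold jacobiInt
  rw [intervalIntegral.integral_of_le (by norm_num), intervalIntegral.integral_of_le (by norm_num),
    MeasureTheory.integral_Ioc_eq_integral_Ioo, MeasureTheory.integral_Ioc_eq_integral_Ioo]
  refine MeasureTheory.setIntegral_congr_fun measurableSet_Ioo fun t ht => ?_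
  have h1 : 0 < 1 - t := by linarith [ht.2]
  have h2 : 0 < 1 + t := by linarith [ht.1]
  simp only [Real.rpow_add_one h1.ne', Real.rpow_add_one h2.ne', eval_mul, eval_sub, eval_X,
    eval_pow, eval_one]
  ring

lemma jacobiInt_one {α β : ℝ} (hα : -1 < α) (hβ : -1 < β) :
    jacobiInt α β 1 = 2 ^ (α + β + 1) *
      (Real.Gamma (α + 1) * Real.Gamma (β + 1) / Real.Gamma (α + β + 2)) := by
  have hbeta : ∫ u in (0 : ℝ)..1, u ^ β * (1 - u) ^ α =
      Real.Gamma (β + 1) * Real.Gamma (α + 1) / Real.Gamma (β + 1 + (α + 1)) := by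
    have h := ProbabilityTheory.beta_eq_betaIntegralReal (β + 1) (α + 1) (by linarith) (by linarith)
    rw [ProbabilityTheory.beta] at h
    rw [h, Complex.betaIntegral]
    have : ∀ r : ℝ, r = (r : ℂ).re := fun r => rfl
    rw [this (∫ u in (0 : ℝ)..1, u ^ β * (1 - u) ^ α), ← intervalIntegral.integral_ofReal]
    congr 1
    refine intervalIntegral.integral_congr fun u hu => ?_
    rw [Set.uIcc_of_le zero_le_one] at hu
    have h0 : 0 ≤ u := hu.1
    have h1 : 0 ≤ 1 - u := by linarith [hu.2]
    simp only [Complex.ofReal_mul, Complex.ofReal_cpow h0, Complex.ofReal_cpow h1]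
    push_cast
    simp
  have hsub := intervalIntegral.integral_comp_mul_sub (a := 0) (b := 1)
    (fun t : ℝ => (1 - t) ^ α * (1 + t) ^ β) (c := 2) two_ne_zero 1
  have hint : ∫ u in (0 : ℝ)..1, (1 - (2 * u - 1)) ^ α * (1 + (2 * u - 1)) ^ β =
      2 ^ (α + β) * ∫ u in (0 : ℝ)..1, u ^ β * (1 - u) ^ α := by
    rw [← intervalIntegral.integral_const_mul]
    refine intervalIntegral.integral_congr fun u hu => ?_
    rw [Set.uIcc_of_le zero_le_one] at hu
    have h0 : 0 ≤ u := hu.1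
    have h1 : 0 ≤ 1 - u := by linarith [hu.2]
    have e1 : 1 - (2 * u - 1) = 2 * (1 - u) := by ring
    have e2 : 1 + (2 * u - 1) = 2 * u := by ring
    simp only [e1, e2]
    rw [Real.mul_rpow zero_le_two h1, Real.mul_rpow zero_le_two h0, Real.rpow_add two_pos]
    ring
  rw [hint, hbeta] at hsub
  norm_num at hsub
  have e : β + 1 + (α + 1) = α + β + 2 := by ring
  rw [e] at hsub
  simp only [jacobiInt, eval_one, mul_one]
  rw [Real.rpow_add_one two_ne_zero]
  linear_combination (-2) * hsub

/-- The functional is positive: a nonzero polynomial that is nonnegative on `(-1, 1)` has a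
positive integral. -/
lemma jacobiInt_pos {α β : ℝ} (hα : -1 < α) (hβ : -1 < β) {p : ℝ[X]} (hp : p ≠ 0)
    (hnn : ∀ t ∈ Set.Ioo (-1 : ℝ) 1, 0 ≤ p.eval t) : 0 < jacobiInt α β p := by
  have hw : ∀ t ∈ Set.Ioo (-1 : ℝ) 1, 0 < (1 - t) ^ α * (1 + t) ^ β := fun t ht =>
    mul_pos (Real.rpow_pos_of_pos (by linarith [ht.2]) _)
      (Real.rpow_pos_of_pos (by linarith [ht.1]) _)
  unfold jacobiInt
  have hI := intervalIntegrable_jacobiWeight_mul hα hβ p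
  rw [intervalIntegrable_iff_integrableOn_Ioo_of_le (by norm_num)] at hI
  rw [intervalIntegral.integral_of_le (by norm_num), MeasureTheory.integral_Ioc_eq_integral_Ioo,
    MeasureTheory.setIntegral_pos_iff_support_of_nonneg_ae ?_ hI]
  · have hsub : Set.Ioo (-1 : ℝ) 1 \ (p.roots.toFinset : Set ℝ) ⊆
        (Function.support fun t : ℝ => (1 - t) ^ α * (1 + t) ^ β * p.eval t) ∩
          Set.Ioo (-1 : ℝ) 1 := by
      rintro t ⟨ht, hr⟩
      refine ⟨mul_ne_zero (hw t ht).ne' fun h => hr ?_, ht⟩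
      simpa [hp] using h
    refine lt_of_lt_of_le ?_ (MeasureTheory.measure_mono hsub)
    rw [MeasureTheory.measure_sdiff_null (p.roots.toFinset.finite_toSet.measure_zero _)]
    simp
  · filter_upwards [MeasureTheory.ae_restrict_mem measurableSet_Ioo] with t ht
    exact mul_nonneg (hw t ht).le (hnn t ht)

/-! ### Derivative, Rodrigues step and leading coefficient -/

lemma ascPochhammer_eval_succ_left (n : ℕ) (a : ℝ) :
    (ascPochhammer ℝ (n + 1)).eval a = a * (ascPochhammer ℝ n).eval (a + 1) := by
  simp [ascPochhammer_succ_left]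

lemma jacobiPoly_zero (α β : ℝ) : jacobiPoly 0 α β = 1 := by
  simp [jacobiPoly]

lemma derivative_jacobiPoly_succ (N : ℕ) (α β : ℝ) :
    derivative (jacobiPoly (N + 1) α β) =
      C (((N : ℝ) + α + β + 2) / 2) * jacobiPoly N (α + 1) (β + 1) := by
  unfold jacobiPoly
  rw [derivative_C_mul, derivative_sum, Finset.sum_range_succ', ← mul_assoc, ← C_mul]
  simp only [pow_zero, mul_one, derivative_C, add_zero, Finset.mul_sum]
  refine Finset.sum_congr rfl fun k _ => ?_
  have hy : derivative (C (1 / 2 : ℝ) * (X - 1)) = C (1 / 2 : ℝ) := by simp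
  rw [derivative_C_mul, derivative_pow_succ, hy]
  have hch : ((N : ℝ) + 1) * (N.choose k : ℝ) = ((N + 1).choose (k + 1) : ℝ) * ((k : ℝ) + 1) := by
    exact_mod_cast Nat.add_one_mul_choose_eq N k
  have hf : (N.factorial : ℝ) ≠ 0 := by positivity
  have hN : (N : ℝ) + 1 ≠ 0 := by positivity
  have e1 : ((N + 1 : ℕ) : ℝ) + α + β + 1 = N + α + β + 2 := by push_cast; ring
  have e2 : (N : ℝ) + (α + 1) + (β + 1) + 1 = N + α + β + 2 + 1 := by ring
  have e3 : α + ((k + 1 : ℕ) : ℝ) + 1 = α + 1 + k + 1 := by push_cast; ring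
  rw [e1, e2, e3, ascPochhammer_eval_succ_left, Nat.add_sub_add_right, Nat.factorial_succ]
  set u := (ascPochhammer ℝ k).eval ((N : ℝ) + α + β + 2 + 1)
  set v := (ascPochhammer ℝ (N - k)).eval (α + 1 + k + 1)
  set y : ℝ[X] := C (1 / 2 : ℝ) * (X - 1)
  have hs : (((N + 1) * N.factorial : ℕ) : ℝ)⁻¹ *
      (((N + 1).choose (k + 1) : ℝ) * (((N : ℝ) + α + β + 2) * u) * v) * ((k : ℝ) + 1) * (1 / 2) =
      ((N : ℝ) + α + β + 2) / 2 * (N.factorial : ℝ)⁻¹ * ((N.choose k : ℝ) * u * v) := by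
    push_cast
    field_simp
    linear_combination (-(((N : ℝ) + α + β + 2) * u * v)) * hch
  calc _ = C ((((N + 1) * N.factorial : ℕ) : ℝ)⁻¹ *
      (((N + 1).choose (k + 1) : ℝ) * (((N : ℝ) + α + β + 2) * u) * v) * ((k : ℝ) + 1) * (1 / 2)) *
        y ^ k := by
        simp only [C_mul, C_add, C_1]
        ring
    _ = _ := by
        rw [hs, C_mul (a := _ / 2 * _)]
        ring

/-- One step of the Rodrigues formula: dividing
`((1 - t)^(α+1) (1 + t)^(β+1) P_N^{(α+1,β+1)})'` by the weight `(1 - t)^α (1 + t)^β` yields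
`-2 (N + 1) P_{N+1}^{(α,β)}`. -/
lemma jacobiPoly_rodrigues_step (N : ℕ) (α β : ℝ) :
    (C (β - α) - C (α + β + 2) * X) * jacobiPoly N (α + 1) (β + 1) +
        (1 - X ^ 2) * derivative (jacobiPoly N (α + 1) (β + 1)) =
      C (-2 * ((N : ℝ) + 1)) * jacobiPoly (N + 1) α β := by
  have hf : (N.factorial : ℝ) ≠ 0 := by positivity
  have hN : (N : ℝ) + 1 ≠ 0 := by positivity
  set y : ℝ[X] := C (1 / 2 : ℝ) * (X - 1) with hydef
  have hy : derivative y = C (1 / 2 : ℝ) := by simp [y]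
  have hC2 : (C (1 / 2 : ℝ) : ℝ[X]) * 2 = 1 := by
    rw [← C_ofNat, ← C_mul]; norm_num
  have hX : (X : ℝ[X]) = 1 + 2 * y := by
    rw [hydef]; linear_combination (1 - X) * hC2
  -- `d k` and `e k` are the coefficients of the two polynomials in powers of `y = (X - 1) / 2`.
  set d : ℕ → ℝ := fun k => (N.choose k : ℝ) *
    (ascPochhammer ℝ k).eval ((N : ℝ) + (α + 1) + (β + 1) + 1) *
      (ascPochhammer ℝ (N - k)).eval (α + 1 + (k : ℝ) + 1) with hd
  set e : ℕ → ℝ := fun k => ((N + 1).choose k : ℝ) *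
    (ascPochhammer ℝ k).eval (((N + 1 : ℕ) : ℝ) + α + β + 1) *
      (ascPochhammer ℝ (N + 1 - k)).eval (α + (k : ℝ) + 1) with he
  have hQ : jacobiPoly N (α + 1) (β + 1) =
      C ((N.factorial : ℝ)⁻¹) * ∑ k ∈ Finset.range (N + 1), C (d k) * y ^ k := rfl
  have hP : jacobiPoly (N + 1) α β =
      C (((N + 1).factorial : ℝ)⁻¹) * ∑ k ∈ Finset.range (N + 1 + 1), C (e k) * y ^ k := rfl
  have he0 : e 0 = (α + 1) * d 0 := by
    simp only [hd, he, Nat.choose_zero_right, ascPochhammer_zero, eval_one, Nat.sub_zero,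
      ascPochhammer_eval_succ_left, Nat.cast_zero, Nat.cast_one, add_zero]
    ring
  have hes : ∀ k ∈ Finset.range (N + 1),
      e (k + 1) = ((k : ℝ) + 1 + α + 1) * d (k + 1) + ((k : ℝ) + α + β + 2) * d k := by
    intro k hk
    have hkN : k ≤ N := Nat.lt_succ_iff.mp (Finset.mem_range.mp hk)
    have hch : (N.choose (k + 1) : ℝ) * ((k : ℝ) + 1) = (N.choose k : ℝ) * ((N : ℝ) - k) := by
      have := Nat.choose_succ_right_eq N k
      rw [← Nat.cast_sub hkN]
      exact_mod_cast this
    have hpas : ((N + 1).choose (k + 1) : ℝ) = N.choose k + N.choose (k + 1) := by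
      exact_mod_cast Nat.choose_succ_succ N k
    have e1 : ((N + 1 : ℕ) : ℝ) + α + β + 1 = N + α + β + 2 := by push_cast; ring
    have e2 : (N : ℝ) + (α + 1) + (β + 1) + 1 = N + α + β + 2 + 1 := by ring
    have e3 : α + ((k + 1 : ℕ) : ℝ) + 1 = α + 1 + k + 1 := by push_cast; ring
    have hshift : ((k : ℝ) + 1 + α + 1) * d (k + 1) = (N.choose (k + 1) : ℝ) *
        (ascPochhammer ℝ (k + 1)).eval ((N : ℝ) + α + β + 2 + 1) *
          (ascPochhammer ℝ (N - k)).eval (α + 1 + (k : ℝ) + 1) := by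
      rcases hkN.lt_or_eq with h | h
      · obtain ⟨m, rfl⟩ : ∃ m, N = k + 1 + m := ⟨N - (k + 1), by omega⟩
        have hm : k + 1 + m - k = m + 1 := by omega
        simp only [hd]
        rw [hm, Nat.add_sub_cancel_left, ascPochhammer_eval_succ_left m, e2]
        have e4 : α + 1 + ((k + 1 : ℕ) : ℝ) + 1 = α + 1 + k + 1 + 1 := by push_cast; ring
        rw [e4]
        ring
      · subst h
        simp [hd]
    rw [hshift]
    simp only [hd, he]
    rw [e1, e2, e3, Nat.add_sub_add_right, ascPochhammer_eval_succ_left k, ascPochhammer_succ_eval,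
      hpas]
    linear_combination (-1 : ℝ) * (ascPochhammer ℝ k).eval ((N : ℝ) + α + β + 2 + 1) *
      (ascPochhammer ℝ (N - k)).eval (α + 1 + (k : ℝ) + 1) * hch
  have hdlast : d (N + 1) = 0 := by simp [hd]
  have hterm : ∀ k : ℕ, (C (β - α) - C (α + β + 2) * X) * (C (d k) * y ^ k) +
      (1 - X ^ 2) * derivative (C (d k) * y ^ k) =
      C (-2) * (C (((k : ℝ) + α + 1) * d k) * y ^ k) +
        C (-2) * (C (((k : ℝ) + α + β + 2) * d k) * y ^ (k + 1)) := by
    intro k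
    have hpow : (1 - X ^ 2) * derivative (C (d k) * y ^ k) =
        C (-2 * k * d k) * (y ^ k + y ^ (k + 1)) := by
      rw [derivative_C_mul, hX]
      rcases k with _ | k
      · simp
      · rw [derivative_pow_succ, hy]
        simp only [C_mul, C_neg, C_ofNat, C_add, C_1, Nat.cast_add, Nat.cast_one, map_natCast]
        linear_combination (-2 * ((k : ℝ[X]) + 1) * y ^ (k + 1) * (1 + y) * C (d (k + 1))) * hC2
    rw [hpow, hX]
    simp only [C_mul, C_neg, C_ofNat, C_add, C_1, C_sub, map_natCast]
    ring
  have hsum : (C (β - α) - C (α + β + 2) * X) * (∑ k ∈ Finset.range (N + 1), C (d k) * y ^ k) +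
      (1 - X ^ 2) * derivative (∑ k ∈ Finset.range (N + 1), C (d k) * y ^ k) =
      C (-2) * ∑ k ∈ Finset.range (N + 1 + 1), C (e k) * y ^ k := by
    rw [derivative_sum, Finset.mul_sum, Finset.mul_sum, ← Finset.sum_add_distrib,
      Finset.sum_congr rfl fun k _ => hterm k, Finset.sum_add_distrib, ← Finset.mul_sum,
      ← Finset.mul_sum, ← mul_add]
    congr 1
    have hext : ∑ k ∈ Finset.range (N + 1), C (((k : ℝ) + α + 1) * d k) * y ^ k =
        ∑ k ∈ Finset.range (N + 1 + 1), C (((k : ℝ) + α + 1) * d k) * y ^ k := by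
      rw [Finset.sum_range_succ _ (N + 1), hdlast]
      simp
    rw [hext, Finset.sum_range_succ', Finset.sum_range_succ' _ (N + 1), he0, add_right_comm,
      ← Finset.sum_add_distrib]
    congr 1
    · refine Finset.sum_congr rfl fun k hk => ?_
      rw [hes k hk, C_add]
      push_cast
      ring
    · simp
  rw [hQ, hP, derivative_C_mul, Nat.factorial_succ]
  have hc : (C (-2 * ((N : ℝ) + 1)) : ℝ[X]) * C ((((N + 1) * N.factorial : ℕ) : ℝ)⁻¹) =
      C ((N.factorial : ℝ)⁻¹) * C (-2) := by
    rw [← C_mul, ← C_mul]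
    congr 1
    push_cast
    field_simp
  linear_combination C ((N.factorial : ℝ)⁻¹) * hsum -
    (∑ k ∈ Finset.range (N + 1 + 1), C (e k) * y ^ k) * hc

lemma natDegree_jacobiPoly_le (N : ℕ) (α β : ℝ) : (jacobiPoly N α β).natDegree ≤ N := by
  unfold jacobiPoly
  refine (natDegree_C_mul_le _ _).trans (natDegree_sum_le_of_forall_le _ _ fun k hk => ?_)
  refine (natDegree_C_mul_le _ _).trans (natDegree_pow_le.trans ?_)
  have h1 : (C (1 / 2 : ℝ) * (X - 1)).natDegree ≤ 1 :=
    (natDegree_C_mul_le _ _).trans (natDegree_X_sub_C_le (1 : ℝ))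
  have := Finset.mem_range.mp hk
  nlinarith

lemma coeff_jacobiPoly (N : ℕ) (α β : ℝ) :
    (jacobiPoly N α β).coeff N =
      (ascPochhammer ℝ N).eval ((N : ℝ) + α + β + 1) / (N.factorial * 2 ^ N) := by
  unfold jacobiPoly
  have hy : ∀ k, (C (1 / 2 : ℝ) * (X - 1)) ^ k = C ((1 / 2 : ℝ) ^ k) * (X - C 1) ^ k := by
    intro k; rw [mul_pow, C_pow, C_1]
  have hdeg : ∀ k, ((X - C (1 : ℝ)) ^ k).natDegree = k := by
    intro k; rw [natDegree_pow, natDegree_X_sub_C, mul_one]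
  rw [coeff_C_mul, finsetSum_coeff, Finset.sum_range_succ, Finset.sum_eq_zero, zero_add]
  · have h1 : ((X - C (1 : ℝ)) ^ N).coeff N = 1 := by
      have := ((monic_X_sub_C (1 : ℝ)).pow N).coeff_natDegree
      rwa [hdeg] at this
    rw [hy, coeff_C_mul, coeff_C_mul, h1]
    simp
    field_simp
  · intro k hk
    rw [hy, coeff_C_mul, coeff_C_mul, coeff_eq_zero_of_natDegree_lt (p := (X - C (1 : ℝ)) ^ k)]
    · simp
    · rw [hdeg]; exact Finset.mem_range.mp hk

lemma coeff_jacobiPoly_pos (n : ℕ) {α β : ℝ} (hα : -1 < α) (hβ : -1 < β) :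
    0 < (jacobiPoly (n + 1) α β).coeff (n + 1) := by
  rw [coeff_jacobiPoly]
  refine div_pos (ascPochhammer_pos _ _ ?_) (by positivity)
  push_cast
  linarith [(Nat.cast_nonneg n : (0 : ℝ) ≤ n)]

lemma natDegree_jacobiPoly (n : ℕ) {α β : ℝ} (hα : -1 < α) (hβ : -1 < β) :
    (jacobiPoly (n + 1) α β).natDegree = n + 1 :=
  natDegree_eq_of_le_of_coeff_ne_zero (natDegree_jacobiPoly_le _ _ _)
    (coeff_jacobiPoly_pos n hα hβ).ne'

lemma jacobiPoly_ne_zero (n : ℕ) {α β : ℝ} (hα : -1 < α) (hβ : -1 < β) :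
    jacobiPoly (n + 1) α β ≠ 0 := by
  intro h
  simpa [h] using coeff_jacobiPoly_pos n hα hβ

/-! ### Orthogonality, norm and the Gauss–Jacobi weights -/

lemma jacobiInt_jacobiPoly_succ_mul (N : ℕ) {α β : ℝ} (hα : -1 < α) (hβ : -1 < β) (q : ℝ[X]) :
    2 * ((N : ℝ) + 1) * jacobiInt α β (jacobiPoly (N + 1) α β * q) =
      jacobiInt (α + 1) (β + 1) (jacobiPoly N (α + 1) (β + 1) * derivative q) := by
  have hparts := jacobiInt_parts hα hβ (jacobiPoly N (α + 1) (β + 1) * q)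
  have hR := jacobiPoly_rodrigues_step N α β
  have e : (C (β - α) - C (α + β + 2) * X) * (jacobiPoly N (α + 1) (β + 1) * q) +
      (1 - X ^ 2) * derivative (jacobiPoly N (α + 1) (β + 1) * q) =
      C (-2 * ((N : ℝ) + 1)) * (jacobiPoly (N + 1) α β * q) +
        (1 - X ^ 2) * (jacobiPoly N (α + 1) (β + 1) * derivative q) := by
    rw [derivative_mul]
    linear_combination q * hR
  rw [e, jacobiInt_add hα hβ, jacobiInt_C_mul, ← jacobiInt_add_one] at hparts
  linarith

lemma jacobiInt_jacobiPoly_mul_eq_zero (N : ℕ) {α β : ℝ} (hα : -1 < α) (hβ : -1 < β) {q : ℝ[X]}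
    (hq : q.degree < N) : jacobiInt α β (jacobiPoly N α β * q) = 0 := by
  induction N generalizing α β q with
  | zero =>
    have : q = 0 := by
      rw [← degree_eq_bot]
      exact Nat.WithBot.lt_zero_iff.mp hq
    rw [this, mul_zero, jacobiInt_zero]
  | succ N ih =>
    have hstep := jacobiInt_jacobiPoly_succ_mul N hα hβ q
    rcases eq_or_ne q 0 with rfl | h0
    · rw [mul_zero, jacobiInt_zero]
    · have hd : (derivative q).degree < N := by
        refine (degree_derivative_lt h0).trans_le ?_
        rw [degree_eq_natDegree h0] at hq ⊢
        exact_mod_cast Nat.lt_succ_iff.mp (by exact_mod_cast hq)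
      rw [ih (by linarith) (by linarith) hd] at hstep
      have hN : (2 : ℝ) * ((N : ℝ) + 1) ≠ 0 := by positivity
      exact (mul_eq_zero.mp hstep).resolve_left hN

/-- Against a polynomial of degree at most `N`, integration against `P_N` only sees the coefficient
of `X ^ N`. -/
lemma jacobiInt_jacobiPoly_mul (N : ℕ) {α β : ℝ} (hα : -1 < α) (hβ : -1 < β) {q : ℝ[X]}
    (hq : q.natDegree ≤ N) : jacobiInt α β (jacobiPoly N α β * q) =
      q.coeff N * jacobiInt α β (jacobiPoly N α β * X ^ N) := by
  have hlt : (q - C (q.coeff N) * X ^ N).degree < (N : WithBot ℕ) := by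
    rw [degree_lt_iff_coeff_zero]
    intro m hm
    rw [coeff_sub, coeff_C_mul, coeff_X_pow]
    rcases hm.eq_or_lt with rfl | h
    · simp
    · simp [h.ne', coeff_eq_zero_of_natDegree_lt (hq.trans_lt h)]
  have h := jacobiInt_jacobiPoly_mul_eq_zero N hα hβ hlt
  have e : jacobiPoly N α β * (q - C (q.coeff N) * X ^ N) =
      jacobiPoly N α β * q - C (q.coeff N) * (jacobiPoly N α β * X ^ N) := by ring
  rw [e, jacobiInt_sub hα hβ, jacobiInt_C_mul] at h
  linarith

lemma jacobiInt_jacobiPoly_sq_succ (N : ℕ) {α β : ℝ} (hα : -1 < α) (hβ : -1 < β) :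
    4 * ((N : ℝ) + 1) * jacobiInt α β (jacobiPoly (N + 1) α β * jacobiPoly (N + 1) α β) =
      ((N : ℝ) + α + β + 2) * jacobiInt (α + 1) (β + 1)
        (jacobiPoly N (α + 1) (β + 1) * jacobiPoly N (α + 1) (β + 1)) := by
  have h := jacobiInt_jacobiPoly_succ_mul N hα hβ (jacobiPoly (N + 1) α β)
  rw [derivative_jacobiPoly_succ, mul_left_comm, jacobiInt_C_mul] at h
  linarith

/-- The squared norm of `P_{n+1}^{(α,β)}`, by lowering the degree and raising both exponents until
only a Beta integral is left. -/
lemma jacobiInt_jacobiPoly_sq (n : ℕ) {α β : ℝ} (hα : -1 < α) (hβ : -1 < β) :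
    (2 * (n : ℝ) + α + β + 3) *
        jacobiInt α β (jacobiPoly (n + 1) α β * jacobiPoly (n + 1) α β) *
        ((n + 1).factorial * Real.Gamma ((n : ℝ) + α + β + 2)) =
      2 ^ (α + β + 1) * (Real.Gamma ((n : ℝ) + α + 2) * Real.Gamma ((n : ℝ) + β + 2)) := by
  have hpow : (2 : ℝ) ^ (α + 1 + (β + 1) + 1) = 4 * 2 ^ (α + β + 1) := by
    have e : α + 1 + (β + 1) + 1 = α + β + 1 + 2 := by ring
    rw [e, Real.rpow_add two_pos]
    norm_num
    ring
  induction n generalizing α β with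
  | zero =>
    have h := jacobiInt_jacobiPoly_sq_succ 0 hα hβ
    rw [jacobiPoly_zero, one_mul, jacobiInt_one (by linarith) (by linarith), hpow] at h
    have e1 : α + 1 + (β + 1) + 2 = α + β + 2 + 1 + 1 := by ring
    have e2 : α + 1 + 1 = α + 2 := by ring
    have e3 : β + 1 + 1 = β + 2 := by ring
    rw [e1, e2, e3, Real.Gamma_add_one (s := α + β + 2 + 1) (by linarith),
      Real.Gamma_add_one (s := α + β + 2) (by linarith)] at h
    have hG : Real.Gamma (α + β + 2) ≠ 0 := (Real.Gamma_pos_of_pos (by linarith)).ne'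
    have h2 : α + β + 2 ≠ 0 := by linarith
    have h3 : α + β + 2 + 1 ≠ 0 := by linarith
    simp only [Nat.cast_zero, zero_add, mul_zero, mul_one] at h ⊢
    field_simp at h
    simp only [Nat.factorial_one, Nat.cast_one, one_mul]
    linear_combination h
  | succ n ih =>
    have hn : (0 : ℝ) ≤ n := Nat.cast_nonneg n
    have h := jacobiInt_jacobiPoly_sq_succ (n + 1) hα hβ
    have hp : (2 : ℝ) ^ (α + 1 + 1 + (β + 1 + 1) + 1) = 4 * 2 ^ (α + 1 + (β + 1) + 1) := by
      have e : α + 1 + 1 + (β + 1 + 1) + 1 = α + 1 + (β + 1) + 1 + 2 := by ring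
      rw [e, Real.rpow_add two_pos]
      norm_num
      ring
    have ih' := ih (α := α + 1) (β := β + 1) (by linarith) (by linarith) hp
    rw [hpow] at ih'
    have e1 : (n : ℝ) + (α + 1) + (β + 1) + 2 = ((n + 1 : ℕ) : ℝ) + α + β + 2 + 1 := by
      push_cast; ring
    have e2 : (n : ℝ) + (α + 1) + 2 = ((n + 1 : ℕ) : ℝ) + α + 2 := by push_cast; ring
    have e3 : (n : ℝ) + (β + 1) + 2 = ((n + 1 : ℕ) : ℝ) + β + 2 := by push_cast; ring
    rw [e1, e2, e3, Real.Gamma_add_one (by push_cast; linarith)] at ih'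
    rw [Nat.factorial_succ (n + 1)]
    push_cast at h ih' ⊢
    linear_combination (1 / 4 : ℝ) * ih' + (2 * (n : ℝ) + α + β + 5) / 4 *
      ((n + 1).factorial * Real.Gamma ((n : ℝ) + 1 + α + β + 2)) * h

/-- The Gauss–Jacobi weight at a root `a`, written without division: with `P = (X - a) S` one has
`S a = P' a`, and the weight at `a` is the integral of the fundamental polynomial `S / S a`. -/
lemma gaussJacobi_weight_identity (n : ℕ) {α β : ℝ} (hα : -1 < α) (hβ : -1 < β) {a : ℝ} {S : ℝ[X]}
    (hS : jacobiPoly (n + 1) α β = (X - C a) * S) :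
    (1 - a ^ 2) * S.eval a * jacobiInt α β S =
      (2 * (n : ℝ) + α + β + 3) *
        jacobiInt α β (jacobiPoly (n + 1) α β * jacobiPoly (n + 1) α β) := by
  have hPdeg := natDegree_jacobiPoly n hα hβ
  have hP0 := jacobiPoly_ne_zero n hα hβ
  set P := jacobiPoly (n + 1) α β with hPdef
  have hS0 : S ≠ 0 := by rintro rfl; exact hP0 (by rw [hS, mul_zero])
  have hSdeg : S.natDegree = n := by
    have := hPdeg
    rw [hS, natDegree_mul (X_sub_C_ne_zero a) hS0, natDegree_X_sub_C] at this
    omega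
  have hScoeff : S.coeff n = P.coeff (n + 1) := by
    rw [hS, sub_mul, coeff_sub, coeff_X_mul, coeff_C_mul,
      coeff_eq_zero_of_natDegree_lt (by omega : S.natDegree < n + 1)]
    ring
  set M := jacobiInt α β (P * X ^ (n + 1)) with hM
  have hmul : ∀ q : ℝ[X], q.natDegree ≤ n + 1 → jacobiInt α β (P * q) = q.coeff (n + 1) * M :=
    fun q hq => jacobiInt_jacobiPoly_mul (n + 1) hα hβ hq
  have hh : jacobiInt α β (P * P) = P.coeff (n + 1) * M := hmul P hPdeg.le
  have hPS : jacobiInt α β (P * S) = 0 := by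
    rw [hmul S (by omega), coeff_eq_zero_of_natDegree_lt (by omega : S.natDegree < n + 1), zero_mul]
  have hPXS : jacobiInt α β (P * (X * S)) = jacobiInt α β (P * P) := by
    rw [hmul _ (by rw [natDegree_X_mul hS0, hSdeg]), hh, coeff_X_mul, hScoeff]
  have hdS : (derivative S).natDegree ≤ n - 1 := (natDegree_derivative_le S).trans (by omega)
  have hPdS : jacobiInt α β (P * ((1 - X ^ 2) * derivative S)) =
      -(n : ℝ) * jacobiInt α β (P * P) := by
    rcases n with _ | m
    · have : derivative S = 0 := derivative_of_natDegree_zero hSdeg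
      simp [this, jacobiInt_zero]
    · have hd1 : ((1 - X ^ 2 : ℝ[X]) * derivative S).natDegree ≤ m + 1 + 1 := by
        refine natDegree_mul_le.trans ?_
        have : (1 - X ^ 2 : ℝ[X]).natDegree ≤ 2 := by compute_degree
        omega
      have hc : ((1 - X ^ 2 : ℝ[X]) * derivative S).coeff (m + 1 + 1) =
          -((m + 1 : ℕ) : ℝ) * P.coeff (m + 1 + 1) := by
        rw [sub_mul, one_mul, coeff_sub, coeff_eq_zero_of_natDegree_lt (by omega), coeff_X_pow_mul,
          coeff_derivative, hScoeff]
        push_cast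
        ring
      rw [hmul _ hd1, hc, hh]
      ring
  -- Integration by parts moves the derivative from `P` to the rest.
  have hdP : jacobiInt α β ((1 - X ^ 2) * derivative P * S) =
      ((n : ℝ) + α + β + 2) * jacobiInt α β (P * P) := by
    have hp := jacobiInt_parts hα hβ (P * S)
    have e : (C (β - α) - C (α + β + 2) * X) * (P * S) + (1 - X ^ 2) * derivative (P * S) =
        C (β - α) * (P * S) - C (α + β + 2) * (P * (X * S)) + (1 - X ^ 2) * derivative P * S +
          P * ((1 - X ^ 2) * derivative S) := by
      rw [derivative_mul]; ring
    rw [e, jacobiInt_add hα hβ, jacobiInt_add hα hβ, jacobiInt_sub hα hβ, jacobiInt_C_mul,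
      jacobiInt_C_mul, hPS, hPXS, hPdS] at hp
    linarith
  -- The multiple of `X * P` cancels the top coefficient of `(1 - X²) P'`, so that the quadrature
  -- rule is exact for `r * S`, and it leaves the value at the root `a` unchanged.
  set r : ℝ[X] := (1 - X ^ 2) * derivative P + C ((n : ℝ) + 1) * (X * P) with hr
  have hrdeg : r.degree < (n + 2 : ℕ) := by
    rw [degree_lt_iff_coeff_zero]
    intro m hm
    obtain ⟨k, rfl⟩ : ∃ k, m = k + 2 := ⟨m - 2, by omega⟩
    have hk : n ≤ k := by omega
    rw [hr, sub_mul, one_mul, coeff_add, coeff_sub, coeff_X_pow_mul, coeff_C_mul, coeff_X_mul,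
      coeff_derivative, coeff_derivative,
      coeff_eq_zero_of_natDegree_lt (by omega : P.natDegree < k + 2 + 1)]
    rcases hk.eq_or_lt with rfl | hlt
    · ring
    · rw [coeff_eq_zero_of_natDegree_lt (by omega : P.natDegree < k + 1)]
      ring
  have hra : r.eval a = (1 - a ^ 2) * S.eval a := by
    rw [hr, hS]
    simp [derivative_mul]
  obtain ⟨g, hg⟩ : X - C a ∣ r - C (r.eval a) := X_sub_C_dvd_sub_C_eval
  have hgdeg : g.degree < (n + 1 : ℕ) := by
    rcases eq_or_ne g 0 with rfl | hg0
    · rw [degree_zero]; exact WithBot.bot_lt_coe _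
    · have h0 : (0 : WithBot ℕ) < (n + 2 : ℕ) := by exact_mod_cast (by omega : 0 < n + 2)
      have h1 : (r - C (r.eval a)).degree < (n + 2 : ℕ) :=
        (degree_sub_le _ _).trans_lt (max_lt hrdeg (degree_C_le.trans_lt h0))
      rw [hg, degree_mul, degree_X_sub_C, degree_eq_natDegree hg0] at h1
      rw [degree_eq_natDegree hg0]
      have h2 : 1 + g.natDegree < n + 2 := by exact_mod_cast h1
      exact_mod_cast (by omega : g.natDegree < n + 1)
  have hrS : jacobiInt α β (r * S) = r.eval a * jacobiInt α β S := by
    have e : r * S = C (r.eval a) * S + P * g := by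
      rw [hS]
      linear_combination S * hg
    rw [e, jacobiInt_add hα hβ, jacobiInt_C_mul, jacobiInt_jacobiPoly_mul_eq_zero _ hα hβ hgdeg,
      add_zero]
  have hrS' : jacobiInt α β (r * S) = (2 * (n : ℝ) + α + β + 3) * jacobiInt α β (P * P) := by
    have e : r * S = (1 - X ^ 2) * derivative P * S + C ((n : ℝ) + 1) * (P * (X * S)) := by
      rw [hr]; ring
    rw [e, jacobiInt_add hα hβ, jacobiInt_C_mul, hdP, hPXS]
    ring
  rw [← hra, ← hrS, hrS']

/-! ### The roots of a Jacobi polynomial -/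

/-- By orthogonality, no nonconstant factor of a Jacobi polynomial keeps its sign on `(-1, 1)`:
if `P = f * S` with `f ≥ 0`, then `0 = ∫ w P S = ∫ w f S²`. -/
lemma not_forall_nonneg_of_jacobiPoly_eq_mul (n : ℕ) {α β : ℝ} (hα : -1 < α) (hβ : -1 < β)
    {f S : ℝ[X]} (hfS : jacobiPoly (n + 1) α β = f * S) (hf : 0 < f.natDegree)
    (hnn : ∀ t ∈ Set.Ioo (-1 : ℝ) 1, 0 ≤ f.eval t) : False := by
  have hP0 := jacobiPoly_ne_zero n hα hβ
  have hdeg := natDegree_jacobiPoly n hα hβ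
  have hf0 : f ≠ 0 := by rintro rfl; exact hP0 (by rw [hfS, zero_mul])
  have hS0 : S ≠ 0 := by rintro rfl; exact hP0 (by rw [hfS, mul_zero])
  rw [hfS, natDegree_mul hf0 hS0] at hdeg
  have hz := jacobiInt_jacobiPoly_mul_eq_zero (n + 1) hα hβ (q := S) (by
    rw [degree_eq_natDegree hS0]; exact_mod_cast (by omega : S.natDegree < n + 1))
  rw [hfS] at hz
  refine (jacobiInt_pos hα hβ (p := f * S * S) (mul_ne_zero (mul_ne_zero hf0 hS0) hS0)
    fun t ht => ?_).ne' hz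
  rw [eval_mul, eval_mul, mul_assoc]
  exact mul_nonneg (hnn t ht) (mul_self_nonneg _)

lemma exists_isRoot_of_dvd_jacobiPoly (n : ℕ) {α β : ℝ} (hα : -1 < α) (hβ : -1 < β) {f : ℝ[X]}
    (hf : f ∣ jacobiPoly (n + 1) α β) (hdeg : 0 < f.natDegree) :
    ∃ t ∈ Set.Ioo (-1 : ℝ) 1, f.IsRoot t := by
  obtain ⟨S, hS⟩ := hf
  by_contra! hno
  have hsign : (∀ t ∈ Set.Ioo (-1 : ℝ) 1, 0 ≤ f.eval t) ∨
      ∀ t ∈ Set.Ioo (-1 : ℝ) 1, f.eval t ≤ 0 := by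
    by_contra! h
    obtain ⟨⟨s, hs, hs'⟩, t, ht, ht'⟩ := h
    obtain ⟨u, hu, hu'⟩ := isPreconnected_Ioo.intermediate_value hs ht f.continuous.continuousOn
      ⟨hs'.le, ht'.le⟩
    exact hno u hu hu'
  rcases hsign with h | h
  · exact not_forall_nonneg_of_jacobiPoly_eq_mul n hα hβ hS hdeg h
  · refine not_forall_nonneg_of_jacobiPoly_eq_mul n hα hβ (f := -f) (S := -S) (by rw [hS]; ring)
      (by rwa [natDegree_neg]) fun t ht => ?_
    rw [eval_neg]
    linarith [h t ht]

lemma mem_Ioo_of_isRoot_jacobiPoly (n : ℕ) {α β : ℝ} (hα : -1 < α) (hβ : -1 < β) {a : ℝ}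
    (ha : (jacobiPoly (n + 1) α β).IsRoot a) : a ∈ Set.Ioo (-1 : ℝ) 1 := by
  obtain ⟨t, ht, hr⟩ := exists_isRoot_of_dvd_jacobiPoly n hα hβ (dvd_iff_isRoot.mpr ha)
    (by rw [natDegree_X_sub_C]; exact one_pos)
  rw [root_X_sub_C] at hr
  exact hr ▸ ht

/-- Every irreducible factor has a root in `(-1, 1)`, hence is linear. -/
lemma splits_jacobiPoly (n : ℕ) {α β : ℝ} (hα : -1 < α) (hβ : -1 < β) :
    (jacobiPoly (n + 1) α β).Splits := by
  obtain ⟨u, hu⟩ := UniqueFactorizationMonoid.factors_prod (jacobiPoly_ne_zero n hα hβ)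
  rw [← hu]
  refine (Splits.multisetProd fun g hg => ?_).mul u.isUnit.splits
  have hirr := UniqueFactorizationMonoid.irreducible_of_factor g hg
  obtain ⟨t, -, ht⟩ := exists_isRoot_of_dvd_jacobiPoly n hα hβ
    (UniqueFactorizationMonoid.dvd_of_mem_factors hg) hirr.natDegree_pos
  exact Splits.of_degree_eq_one (degree_eq_one_of_irreducible_of_root hirr ht)

/-- The roots are simple, as `(X - a) ^ 2` keeps its sign. -/
lemma nodup_roots_jacobiPoly (n : ℕ) {α β : ℝ} (hα : -1 < α) (hβ : -1 < β) :
    (jacobiPoly (n + 1) α β).roots.Nodup := by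
  rw [Multiset.nodup_iff_count_le_one]
  intro a
  rw [count_roots]
  by_contra! h
  obtain ⟨S, hS⟩ := (le_rootMultiplicity_iff (jacobiPoly_ne_zero n hα hβ)).mp
    (show 2 ≤ rootMultiplicity a (jacobiPoly (n + 1) α β) from h)
  refine not_forall_nonneg_of_jacobiPoly_eq_mul n hα hβ hS ?_ fun t _ => ?_
  · rw [natDegree_pow, natDegree_X_sub_C]; norm_num
  · rw [eval_pow]
    exact sq_nonneg _

lemma exists_enumeratesJacobiRoots (n : ℕ) {α β : ℝ} (hα : -1 < α) (hβ : -1 < β) :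
    ∃ x : Fin (n + 1) → ℝ, StrictMono x ∧ EnumeratesJacobiRoots α β x := by
  have hcard : (jacobiPoly (n + 1) α β).roots.toFinset.card = n + 1 := by
    rw [Multiset.toFinset_card_of_nodup (nodup_roots_jacobiPoly n hα hβ),
      ← (splits_jacobiPoly n hα hβ).natDegree_eq_card_roots, natDegree_jacobiPoly n hα hβ]
  refine ⟨_, (Finset.orderEmbOfFin _ hcard).strictMono, fun t => ?_⟩
  rw [← Set.mem_range, Finset.range_orderEmbOfFin, Finset.mem_coe, Multiset.mem_toFinset,
    mem_roots (jacobiPoly_ne_zero n hα hβ)]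

lemma EnumeratesJacobiRoots.eq_C_mul_nodal {n : ℕ} {α β : ℝ} (hα : -1 < α) (hβ : -1 < β)
    {x : Fin (n + 1) → ℝ} (hinj : Function.Injective x) (hx : EnumeratesJacobiRoots α β x) :
    jacobiPoly (n + 1) α β =
      C ((jacobiPoly (n + 1) α β).coeff (n + 1)) * Lagrange.nodal Finset.univ x := by
  have hk := (coeff_jacobiPoly_pos n hα hβ).ne'
  refine eq_of_degree_sub_lt_of_eval_index_eq Finset.univ hinj.injOn ?_ fun j _ => ?_
  · rw [Finset.card_univ, Fintype.card_fin, degree_lt_iff_coeff_zero]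
    intro m hm
    have hnd : (Lagrange.nodal Finset.univ x).natDegree = n + 1 := by
      rw [Lagrange.natDegree_nodal, Finset.card_univ, Fintype.card_fin]
    rw [coeff_sub, coeff_C_mul]
    rcases hm.eq_or_lt with rfl | h
    · have h1 : (Lagrange.nodal Finset.univ x).coeff (n + 1) = 1 := by
        have := (Lagrange.nodal_monic (s := Finset.univ) (v := x)).coeff_natDegree
        rwa [hnd] at this
      rw [h1, mul_one, sub_self]
    · rw [coeff_eq_zero_of_natDegree_lt ((natDegree_jacobiPoly_le _ _ _).trans_lt h),
        coeff_eq_zero_of_natDegree_lt (hnd.trans_lt h), mul_zero, sub_self]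
  · rw [eval_mul, Lagrange.eval_nodal_at_node (Finset.mem_univ j), mul_zero]
    exact (hx (x j)).mpr ⟨j, rfl⟩

/-! ### Barycentric weights: size and sign -/

/-- The squared barycentric weight in terms of the Gauss–Jacobi weight. The left factor is
`(2n+α+β+3)` times the squared norm of `P_{n+1}`. -/
lemma EnumeratesJacobiRoots.mul_baryWeight_sq {n : ℕ} {α β : ℝ} (hα : -1 < α) (hβ : -1 < β)
    {x : Fin (n + 1) → ℝ} (hinj : Function.Injective x) (hx : EnumeratesJacobiRoots α β x)
    (j : Fin (n + 1)) :
    (2 * (n : ℝ) + α + β + 3) *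
        jacobiInt α β (jacobiPoly (n + 1) α β * jacobiPoly (n + 1) α β) * baryWeight x j ^ 2 =
      (jacobiPoly (n + 1) α β).coeff (n + 1) ^ 2 *
        ((1 - x j ^ 2) * gaussJacobiWeight α β x j) := by
  set k := (jacobiPoly (n + 1) α β).coeff (n + 1) with hk
  set T := Lagrange.nodal (Finset.univ.erase j) x with hT
  have hS : jacobiPoly (n + 1) α β = (X - C (x j)) * (C k * T) := by
    rw [hx.eq_C_mul_nodal hα hβ hinj, Lagrange.nodal_eq_mul_nodal_erase (Finset.mem_univ j)]
    ring
  have hid := gaussJacobi_weight_identity n hα hβ hS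
  have hTe : T.eval (x j) = ∏ i ∈ Finset.univ.erase j, (x j - x i) := Lagrange.eval_nodal
  have hT0 : T.eval (x j) ≠ 0 := by
    rw [hTe, Finset.prod_ne_zero_iff]
    exact fun i hi => sub_ne_zero.mpr fun h => (Finset.mem_erase.mp hi).1 (hinj h).symm
  have hb : baryWeight x j = (T.eval (x j))⁻¹ := by rw [baryWeight, hTe, one_div]
  have hw : gaussJacobiWeight α β x j = (T.eval (x j))⁻¹ * jacobiInt α β T := by
    rw [← jacobiInt_C_mul, ← Lagrange.nodalWeight_eq_eval_nodal_erase_inv]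
    change jacobiInt α β _ = _
    rw [Lagrange.basis_eq_prod_sub_inv_mul_nodal_div (Finset.mem_univ j),
      ← Lagrange.nodal_erase_eq_nodal_div (Finset.mem_univ j)]
  rw [← hid, hb, hw, jacobiInt_C_mul, eval_mul, eval_C]
  field_simp

/-- The sign of `λ_j` is that of the number of nodes to the right of `x_j`. -/
lemma baryWeight_eq_neg_one_pow_mul_abs {n : ℕ} (x : Fin (n + 1) → ℝ) (j : Fin (n + 1)) :
    baryWeight x j =
      (-1) ^ (Finset.univ.filter fun k => x j < x k).card * |baryWeight x j| := by
  have hprod : ∏ k ∈ Finset.univ.erase j, (x j - x k) =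
      (-1) ^ (Finset.univ.filter fun k => x j < x k).card *
        |∏ k ∈ Finset.univ.erase j, (x j - x k)| := by
    have hfil : (Finset.univ.filter fun k => x j < x k) =
        (Finset.univ.erase j).filter fun k => x j < x k := by
      ext k
      simp only [Finset.mem_filter, Finset.mem_univ, true_and, Finset.mem_erase, and_true]
      exact ⟨fun h => ⟨fun e => (e ▸ h).false, h⟩, fun h => h.2⟩
    rw [hfil, ← Finset.prod_const, Finset.prod_filter, Finset.abs_prod, ← Finset.prod_mul_distrib]
    refine Finset.prod_congr rfl fun k _ => ?_
    split_ifs with h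
    · rw [abs_of_neg (sub_neg.mpr h)]; ring
    · rw [abs_of_nonneg (sub_nonneg.mpr (not_lt.mp h)), one_mul]
  unfold baryWeight
  conv_lhs => rw [hprod]
  rw [abs_div, abs_one, one_div, one_div, mul_inv, ← inv_pow, inv_neg, inv_one]

lemma baryWeight_of_strictMono {n : ℕ} {x : Fin (n + 1) → ℝ} (hx : StrictMono x)
    (j : Fin (n + 1)) : baryWeight x j = (-1) ^ n * (-1) ^ (j : ℕ) * |baryWeight x j| := by
  have hcard : (Finset.univ.filter fun k => x j < x k).card = n - j := by
    simp_rw [hx.lt_iff_lt]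
    rw [Finset.filter_lt_eq_Ioi, Fin.card_Ioi]
    omega
  have hpow : (-1 : ℝ) ^ (n - (j : ℕ)) = (-1) ^ n * (-1) ^ (j : ℕ) := by
    generalize hi : (j : ℕ) = i
    obtain ⟨m, rfl⟩ := Nat.exists_eq_add_of_le (show i ≤ n by omega)
    rw [Nat.add_sub_cancel_left, pow_add, mul_right_comm, ← mul_pow]
    simp
  rw [← hpow, ← hcard]
  exact baryWeight_eq_neg_one_pow_mul_abs x j

lemma baryWeight_of_strictAnti {n : ℕ} {x : Fin (n + 1) → ℝ} (hx : StrictAnti x)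
    (j : Fin (n + 1)) : baryWeight x j = (-1) ^ (j : ℕ) * |baryWeight x j| := by
  have hcard : (Finset.univ.filter fun k => x j < x k).card = j := by
    simp_rw [hx.lt_iff_gt]
    rw [Finset.filter_gt_eq_Iio, Fin.card_Iio]
  conv_rhs => rw [← hcard]
  exact baryWeight_eq_neg_one_pow_mul_abs x j

/-! ### The normalizing constant -/

lemma ascPochhammer_eval_mul_Gamma (N : ℕ) {s : ℝ} (hs : 0 < s) :
    (ascPochhammer ℝ N).eval s * Real.Gamma s = Real.Gamma (s + N) := by
  induction N with
  | zero => simp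
  | succ N ih =>
    rw [ascPochhammer_succ_eval, Nat.cast_succ, ← add_assoc,
      Real.Gamma_add_one (by positivity), ← ih]
    ring

lemma jacobiSign_eq (n : ℕ) : jacobiSign n = (-1) ^ n := by
  unfold jacobiSign
  split_ifs with h
  · rw [h.neg_one_pow]
  · rw [(Nat.not_even_iff_odd.mp h).neg_one_pow]

lemma neg_one_pow_mul_jacobiConst_pos (n : ℕ) {α β : ℝ} (hα : -1 < α) (hβ : -1 < β) :
    0 < (-1) ^ n * jacobiConst n α β := by
  have hn : (0 : ℝ) ≤ n := Nat.cast_nonneg n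
  have h1 := Real.Gamma_pos_of_pos (s := 2 * (n : ℝ) + α + β + 3) (by linarith)
  have h2 := Real.Gamma_pos_of_pos (s := (n : ℝ) + α + β + 2) (by linarith)
  have h3 := Real.Gamma_pos_of_pos (s := (n : ℝ) + α + 2) (by linarith)
  have h4 := Real.Gamma_pos_of_pos (s := (n : ℝ) + β + 2) (by linarith)
  have hsq : (-1 : ℝ) ^ n * (-1) ^ n = 1 := by rw [← mul_pow]; simp
  rw [jacobiConst, jacobiSign_eq, mul_assoc ((-1 : ℝ) ^ n), ← mul_assoc, hsq, one_mul]
  positivity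

/-- The square of `C_n` is the squared leading coefficient of `P_{n+1}` divided by
`(2n+α+β+3) ‖P_{n+1}‖²`. -/
lemma jacobiConst_sq_mul (n : ℕ) {α β : ℝ} (hα : -1 < α) (hβ : -1 < β) :
    jacobiConst n α β ^ 2 * ((2 * (n : ℝ) + α + β + 3) *
        jacobiInt α β (jacobiPoly (n + 1) α β * jacobiPoly (n + 1) α β)) =
      (jacobiPoly (n + 1) α β).coeff (n + 1) ^ 2 := by
  have hn : (0 : ℝ) ≤ n := Nat.cast_nonneg n
  have h2 := Real.Gamma_pos_of_pos (s := (n : ℝ) + α + β + 2) (by linarith)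
  have h3 := Real.Gamma_pos_of_pos (s := (n : ℝ) + α + 2) (by linarith)
  have h4 := Real.Gamma_pos_of_pos (s := (n : ℝ) + β + 2) (by linarith)
  have hnorm := jacobiInt_jacobiPoly_sq n hα hβ
  have hpoch := ascPochhammer_eval_mul_Gamma (n + 1) (s := (n : ℝ) + α + β + 2) (by linarith)
  have e1 : (n : ℝ) + α + β + 2 + ((n + 1 : ℕ) : ℝ) = 2 * n + α + β + 3 := by push_cast; ring
  have e2 : ((n + 1 : ℕ) : ℝ) + α + β + 1 = n + α + β + 2 := by push_cast; ring
  rw [e1] at hpoch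
  have hsgn : ((-1 : ℝ) ^ n) ^ 2 = 1 := by rw [← pow_mul, mul_comm, pow_mul]; simp
  have hpow : ((2 : ℝ) ^ ((n : ℝ) + 1 + (α + β + 1) / 2)) ^ 2 =
      (2 ^ (n + 1)) ^ 2 * 2 ^ (α + β + 1) := by
    rw [← Real.rpow_natCast, ← Real.rpow_mul zero_le_two, ← pow_mul, ← Real.rpow_natCast 2,
      ← Real.rpow_add two_pos]
    congr 1
    push_cast
    ring
  have hF : (0 : ℝ) < (n + 1).factorial := by positivity
  have hw : (0 : ℝ) < 2 ^ (α + β + 1) := by positivity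
  rw [jacobiConst, jacobiSign_eq, coeff_jacobiPoly, e2, ← hpoch]
  simp only [mul_pow, div_pow, one_pow, hsgn, hpow]
  rw [Real.sq_sqrt (by positivity)]
  set H := (2 * (n : ℝ) + α + β + 3) *
    jacobiInt α β (jacobiPoly (n + 1) α β * jacobiPoly (n + 1) α β)
  have hH : H = 2 ^ (α + β + 1) * (Real.Gamma ((n : ℝ) + α + 2) * Real.Gamma ((n : ℝ) + β + 2)) /
      ((n + 1).factorial * Real.Gamma ((n : ℝ) + α + β + 2)) := by
    rw [eq_div_iff (by positivity)]; exact hnorm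
  rw [hH]
  field_simp

lemma EnumeratesJacobiRoots.abs_baryWeight {n : ℕ} {α β : ℝ} (hα : -1 < α) (hβ : -1 < β)
    {x : Fin (n + 1) → ℝ} (hinj : Function.Injective x) (hx : EnumeratesJacobiRoots α β x)
    (j : Fin (n + 1)) :
    |baryWeight x j| = (-1) ^ n * jacobiConst n α β *
      √((1 - x j ^ 2) * gaussJacobiWeight α β x j) := by
  have hn : (0 : ℝ) ≤ n := Nat.cast_nonneg n
  have hK := neg_one_pow_mul_jacobiConst_pos n hα hβ
  have hP0 := jacobiPoly_ne_zero n hα hβ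
  have hH : 0 < (2 * (n : ℝ) + α + β + 3) *
      jacobiInt α β (jacobiPoly (n + 1) α β * jacobiPoly (n + 1) α β) :=
    mul_pos (by linarith) (jacobiInt_pos hα hβ (mul_ne_zero hP0 hP0) fun t _ => by
      rw [eval_mul]; exact mul_self_nonneg _)
  have hsgn : ((-1 : ℝ) ^ n) ^ 2 = 1 := by rw [← pow_mul, mul_comm, pow_mul]; simp
  have hsq : baryWeight x j ^ 2 = ((-1) ^ n * jacobiConst n α β) ^ 2 *
      ((1 - x j ^ 2) * gaussJacobiWeight α β x j) := by
    refine mul_left_cancel₀ hH.ne' ?_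
    rw [hx.mul_baryWeight_sq hα hβ hinj, ← jacobiConst_sq_mul n hα hβ, mul_pow, hsgn]
    ring
  rw [← Real.sqrt_sq_eq_abs, hsq, Real.sqrt_mul (sq_nonneg _), Real.sqrt_sq hK.le]

theorem corollary2p3 (n : ℕ) (α β : ℝ) (hα : -1 < α) (hβ : -1 < β) :
    -- the polynomial has `n + 1` distinct real roots, all of them in `(-1, 1)`
    (∃ x : Fin (n + 1) → ℝ, StrictMono x ∧ EnumeratesJacobiRoots α β x ∧
      ∀ j, x j ∈ Set.Ioo (-1 : ℝ) 1) ∧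
    -- the full barycentric weights, for the roots in increasing order
    (∀ x : Fin (n + 1) → ℝ, StrictMono x → EnumeratesJacobiRoots α β x →
      ∀ j, baryWeight x j =
        jacobiConst n α β * (-1) ^ (j : ℕ) *
          √((1 - x j ^ 2) * gaussJacobiWeight α β x j)) ∧
    -- the simplified barycentric weights, for the roots in either monotonic order
    (∀ x : Fin (n + 1) → ℝ, (StrictMono x ∨ StrictAnti x) → EnumeratesJacobiRoots α β x →
      IsSimplifiedBaryWeights x
        (fun j => (-1) ^ (j : ℕ) * √((1 - x j ^ 2) * gaussJacobiWeight α β x j))) := by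
  have hK := neg_one_pow_mul_jacobiConst_pos n hα hβ
  have hmono : ∀ x : Fin (n + 1) → ℝ, StrictMono x → EnumeratesJacobiRoots α β x →
      ∀ j, baryWeight x j = jacobiConst n α β * (-1) ^ (j : ℕ) *
        √((1 - x j ^ 2) * gaussJacobiWeight α β x j) := by
    intro x hx hroots j
    have hsgn : (-1 : ℝ) ^ n * (-1) ^ n = 1 := by rw [← mul_pow]; simp
    rw [baryWeight_of_strictMono hx j, hroots.abs_baryWeight hα hβ hx.injective]
    linear_combination jacobiConst n α β * (-1) ^ (j : ℕ) *
      √((1 - x j ^ 2) * gaussJacobiWeight α β x j) * hsgn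
  refine ⟨?_, hmono, fun x hx hroots => ?_⟩
  · obtain ⟨x, hx, hroots⟩ := exists_enumeratesJacobiRoots n hα hβ
    exact ⟨x, hx, hroots, fun j =>
      mem_Ioo_of_isRoot_jacobiPoly n hα hβ ((hroots (x j)).mpr ⟨j, rfl⟩)⟩
  · rcases hx with hx | hx
    · refine ⟨jacobiConst n α β, right_ne_zero_of_mul hK.ne', fun j => ?_⟩
      rw [hmono x hx hroots j, mul_assoc]
    · -- For decreasing nodes `λ_j` has the sign `(-1) ^ j`, so the common factor is `|C_n|`.
      refine ⟨(-1) ^ n * jacobiConst n α β, hK.ne', fun j => ?_⟩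
      rw [baryWeight_of_strictAnti hx j, hroots.abs_baryWeight hα hβ hx.injective]
      ring
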